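/- Strings are finite binary strings, $\epsilon$ is the empty string and $|p|$ is the length of $p$. A self-delimiting machine $T$ takes a program $p$, written on a one-way read-only tape that $T$ scans bit by bit, and auxiliary information $y$; write $T(p,y)=x$ if the computation halts with output $x$ when exactly the bits of $p$ have been scanned. What $T$ does after it has scanned a string $q$ (ask for the next bit, halt with an output, or run forever) is given by a partial computable function of $(q,y)$. A self-delimiting machine $U$ is universal if for every self-delimiting machine $T$ there is a string $r$ such that $U(rq,y)=T(q,y)$ for all $q$ and $y$ (one side is defined if and only if the other is). Fix a universal self-delimiting machine $U$, and let $$K(x\mid y)=\min\{|p| : U(p,y)=x\},\qquad K(x)=K(x\mid\epsilon),\qquad K(x,y)=K(\langle x,y\rangle),$$ where $\langle x,y\rangle=1^{|x|}0xy$. A shortest program of $x$ is a string $x^*$ with $U(x^*,\epsilon)=x$ and $|x^*|=K(x)$. **Theorem (Chain rule for prefix complexity).** For all strings $x$ and $y$, $$K(x,y)=K(x)+K(y\mid x^*)+O(1).$$ That is, there is a constant $c$, depending only on $U$, such that for all strings $x,y$ and every shortest program $x^*$ of $x$, $$\bigl|K(x,y)-K(x)-K(y\mid x^*)\bigr|\le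 c.$$ -/

import Mathlib

/-- A self-delimiting machine. `control q y` is what the machine does once it has scanned exactly
the bits `q` of its one-way read-only program tape, with auxiliary information `y` given on its
work tape: after a computation that can use only `q` and `y`, it either asks for the next program
bit (value `none`), or halts with output `x` (value `some x`), or runs forever (no value). -/
structure SelfDelimitingMachine where
  control : List Bool → List Bool →. Option (List Bool)
  computable : Partrec₂ control

namespace SelfDelimitingMachine

/-- `T.Outputs p y x` is `T(p, y) = x`: with auxiliary information `y`, the machine scans the
program `p` bit by bit and halts with output `x` when it has scanned all of `p` and no further. -/
def Outputs (T : SelfDelimitingMachine) (p y x : List Bool) : Prop :=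
  (∀ q : List Bool, q <+: p → q ≠ p → none ∈ T.control q y) ∧ some x ∈ T.control p y

/-- The machine `U` simulates every self-delimiting machine `T`: there is a fixed string `r`,
depending only on `T`, such that `U(rq, y) = T(q, y)` for all `q` and `y`, one side being defined
if and only if the other is. -/
def IsUniversal (U : SelfDelimitingMachine) : Prop :=
  ∀ T : SelfDelimitingMachine, ∃ r : List Bool, ∀ q y x : List Bool,
    U.Outputs (r ++ q) y x ↔ T.Outputs q y x

/-- `T.condK x y` is `K_T(x | y)`, the least length of a program `p` with `T(p, y) = x`;
it is `⊤` if there is none. -/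
noncomputable def condK (T : SelfDelimitingMachine) (x y : List Bool) : ℕ∞ :=
  ⨅ (p : List Bool) (_ : T.Outputs p y x), (p.length : ℕ∞)

/-- `T.K x` is `K_T(x) = K_T(x | ε)`. -/
noncomputable def K (T : SelfDelimitingMachine) (x : List Bool) : ℕ∞ :=
  T.condK x []

/-- The self-delimiting encoding `1^{|x|} 0 x` of the string `x`. -/
def selfDelimitingCode (x : List Bool) : List Bool :=
  List.replicate x.length true ++ false :: x

/-- The encoding of a pair of strings by a string: the self-delimiting encoding of `x`, then `y`. -/
def pairing (x y : List Bool) : List Bool :=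
  selfDelimitingCode x ++ y

/-- `T.K₂ x y` is the complexity `K_T(x, y)` of the pair `(x, y)`. -/
noncomputable def K₂ (T : SelfDelimitingMachine) (x y : List Bool) : ℕ∞ :=
  T.K (pairing x y)

/-- `p` is a shortest program of `x`: `T(p, ε) = x` and `|p| = K_T(x)`. -/
def IsShortestProgram (T : SelfDelimitingMachine) (p x : List Bool) : Prop :=
  T.Outputs p [] x ∧ (p.length : ℕ∞) = T.K x

/-! The rest shows that universal machines exist and that, for them, every string has a shortest
program. It is not used in the definitions above. -/

/-- The control of a universal machine, which reads `1^i 0 q` and runs the `i`-th code on `q`. -/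
def uctl (s y : List Bool) : Part (Option (List Bool)) :=
  bif decide (s.idxOf false < s.length) then
    (Nat.Partrec.Code.eval (Denumerable.ofNat Nat.Partrec.Code (s.idxOf false))
      (Encodable.encode (s.drop (s.idxOf false + 1), y))).bind
        fun n => Part.ofOption (Encodable.decode n : Option (Option (List Bool)))
  else Part.some none

theorem uctl_partrec : Partrec₂ uctl := by
  have hi : Computable (fun a : List Bool × List Bool => a.1.idxOf false) :=
    (Primrec.list_idxOf.comp (Primrec.const false) Primrec.fst).to_comp
  have hc : Computable (fun a : List Bool × List Bool =>
      decide (a.1.idxOf false < a.1.length)) :=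
    (Primrec.nat_lt.decide.comp
      (Primrec.list_idxOf.comp (Primrec.const false) Primrec.fst)
      (Primrec.list_length.comp Primrec.fst)).to_comp
  have hd : Computable (fun a : List Bool × List Bool =>
      Encodable.encode (a.1.drop (a.1.idxOf false + 1), a.2)) :=
    Computable.encode.comp (((Primrec.list_drop.comp (Primrec.succ.comp
      (Primrec.list_idxOf.comp (Primrec.const false) Primrec.fst)) Primrec.fst).pair
        Primrec.snd).to_comp)
  have h1 : Partrec (fun a : List Bool × List Bool =>
      (Nat.Partrec.Code.eval (Denumerable.ofNat Nat.Partrec.Code (a.1.idxOf false))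
      (Encodable.encode (a.1.drop (a.1.idxOf false + 1), a.2))).bind
        fun n => Part.ofOption (Encodable.decode n : Option (Option (List Bool)))) := by
    refine Partrec.bind (Nat.Partrec.Code.eval_part.comp ((Computable.ofNat Nat.Partrec.Code).comp hi) hd) ?_
    exact Computable.ofOption (Computable.decode.comp Computable.snd)
  exact Partrec.cond hc h1 (Computable.const none).partrec

def univ : SelfDelimitingMachine := ⟨uctl, uctl_partrec⟩

theorem uctl_rep (n : ℕ) (y : List Bool) :
    uctl (List.replicate n true) y = Part.some none := by
  simp [uctl]

theorem uctl_app (T : SelfDelimitingMachine) : ∃ n, ∀ q y,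
    uctl (List.replicate n true ++ false :: q) y = T.control q y := by
  obtain ⟨c, hc⟩ := Nat.Partrec.Code.exists_code.1 T.computable
  refine ⟨Encodable.encode c, fun q y => ?_⟩
  have : ∀ n, (List.replicate n true ++ false :: q).idxOf false = n := by
    intro n
    induction n with
    | zero => rfl
    | succ n ih => simp [List.replicate_succ, ih]
  have h2 : ∀ n, (List.replicate n true ++ false :: q).drop (n+1) = q := by
    intro n
    induction n with
    | zero => rfl
    | succ n ih => simpa [List.replicate_succ] using ih
  unfold uctl
  rw [this, h2, Denumerable.ofNat_encode, hc]
  simp [Part.bind_map]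

theorem univ_isUniversal : univ.IsUniversal := by
  intro T
  obtain ⟨n, hn⟩ := uctl_app T
  refine ⟨List.replicate n true ++ [false], fun q y x => ?_⟩
  unfold Outputs
  simp only [univ, List.append_assoc, List.singleton_append, hn]
  refine and_congr_left fun _ => ⟨fun h s hs hne => ?_, fun h s hs hne => ?_⟩
  · rw [← hn]
    refine h _ ?_ ?_
    · obtain ⟨t, rfl⟩ := hs; exact ⟨t, by simp⟩
    · simpa using hne
  · rcases List.prefix_or_prefix_of_prefix hs (List.prefix_append (List.replicate n true) _) with h1 | ⟨t, rfl⟩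
    · obtain ⟨m, rfl⟩ : ∃ m, s = List.replicate m true :=
        ⟨s.length, by
          rw [List.eq_replicate_iff]; exact ⟨rfl, fun b hb => by
            have := h1.subset hb; simp at this; exact this.2⟩⟩
      rw [uctl_rep]; simp
    · rw [List.prefix_append_right_inj] at hs
      cases t with
      | nil => simp [uctl_rep]
      | cons b t =>
        obtain ⟨rfl, ht⟩ := List.cons_prefix_cons.1 hs
        rw [hn]; exact h t ht (by rintro rfl; exact hne rfl)

theorem exists_isUniversal : ∃ U : SelfDelimitingMachine, U.IsUniversal :=
  ⟨univ, univ_isUniversal⟩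

theorem IsUniversal.exists_isShortestProgram {U : SelfDelimitingMachine} (hU : U.IsUniversal)
    (x : List Bool) : ∃ p, U.IsShortestProgram p x := by
  obtain ⟨r, hr⟩ := hU ⟨fun _ _ => Part.some (some x), (Computable.const _).partrec⟩
  have hne : {p | U.Outputs p [] x}.Nonempty :=
    ⟨r ++ [], (hr [] [] x).2 ⟨fun q hq hne => absurd (List.prefix_nil.1 hq) hne, by simp⟩⟩
  have hm := fun q (hq : U.Outputs q [] x) =>
    Function.argminOn_le List.length {p | U.Outputs p [] x} hq
  refine ⟨Function.argminOn List.length _ hne, Function.argminOn_mem List.length _ hne, ?_⟩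
  refine le_antisymm (le_iInf₂ fun q hq => ?_) (iInf₂_le _ (Function.argminOn_mem _ _ hne))
  exact_mod_cast hm q hq

end SelfDelimitingMachine

/-! For the upper bound, programs are self-delimiting, so `x*` followed by a program of `y` given
`x*` can be parsed by one machine: the prefix it scans until `U` first halts is `x*` itself, which
then serves as auxiliary information (`exists_machine_pairing`).

For the lower bound, let `m(x)` be the sum of `2^{-|q|}` over all programs `q` whose output has
first component `x`. Summed over `x` this is at most `1` by Kraft's inequality, and `m` can be
enumerated from below. The coding theorem (`exists_machine_of_weights`) then gives `m(x) ≤ 2^{c -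
K(x)}`. From `x*` one computes both `x` and `K(x) = |x*|`. Hence, given `x*`, one can enumerate the
programs `q` contributing to `m(x)` and request for each a codeword of length `|q| + c - K(x)` for
the second component of its output. The requested weights sum to at most `2^{K(x) - c} m(x) ≤ 1`, so
the Kraft–Chaitin construction (`exists_machine_of_requests`) serves them all. A shortest program of
the pair yields `K(y | x*) ≤ K(x, y) - K(x) + O(1)`.

The coding theorem itself rests on Kraft–Chaitin: a string requests a new codeword only when its
accumulated weight passes a power of two, so its requests form a geometric series bounded by its
weight. -/

open Encodable

/-! ### Enumeration of graphs without repetition -/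

/-- The graph of a partial computable function can be enumerated so that every argument in the
domain occurs exactly once. -/
theorem exists_enumeration_of_partrec {α β : Type*} [Primcodable α] [Primcodable β] {g : α →. β}
    (hg : Partrec g) :
    ∃ e : ℕ → Option (α × β), Computable e ∧ (∀ a b, b ∈ g a ↔ ∃ i, e i = some (a, b)) ∧
      ∀ i j a b b', e i = some (a, b) → e j = some (a, b') → i = j := by
  have hg' : Partrec fun a => (g a).map fun b => (a, b) := hg.map Computable.id
  obtain ⟨c, hc⟩ := Nat.Partrec.Code.exists_code.1 (Partrec.bind_decode₂_iff.1 hg')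
  have hmem : ∀ n m, m ∈ c.eval n ↔ ∃ a b, encode a = n ∧ b ∈ g a ∧ encode (a, b) = m := by
    intro n m
    rw [hc]
    simp only [Part.mem_bind_iff, Part.mem_ofOption, decode₂_eq_some, Part.mem_map_iff,
      Option.mem_def]
    constructor
    · rintro ⟨a, ha, _, ⟨b, hb, rfl⟩, rfl⟩
      exact ⟨a, b, ha, hb, rfl⟩
    · rintro ⟨a, b, ha, hb, rfl⟩
      exact ⟨a, ha, _, ⟨b, hb, rfl⟩, rfl⟩
  -- Index `i` codes a step bound `k` and an input `n`. A value is emitted only if the computation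
  -- succeeds with bound `k + 1` but not with `k`; this singles out one `k` for each `n`, whence no
  -- repetition.
  let e : ℕ → Option (α × β) := fun i =>
    bif (c.evaln i.unpair.1 i.unpair.2).isNone then
      (c.evaln (i.unpair.1 + 1) i.unpair.2).bind decode else none
  have he : ∀ i p, e i = some p ↔ c.evaln i.unpair.1 i.unpair.2 = none ∧
      ∃ m, c.evaln (i.unpair.1 + 1) i.unpair.2 = some m ∧ decode m = some p := by
    intro i p
    simp only [e]
    cases c.evaln i.unpair.1 i.unpair.2 <;>
      simp [Option.bind_eq_some_iff, -Encodable.decode_prod_val]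
  have he' : ∀ i a b, e i = some (a, b) → i.unpair.2 = encode a ∧ b ∈ g a := by
    intro i a b h
    obtain ⟨-, m, hm, hd⟩ := (he _ _).1 h
    obtain ⟨a', b', h1, h2, rfl⟩ := (hmem _ _).1 (Nat.Partrec.Code.evaln_sound hm)
    rw [encodek] at hd
    obtain ⟨rfl, rfl⟩ := Prod.mk.inj (Option.some.inj hd)
    exact ⟨h1.symm, h2⟩
  refine ⟨e, ?_, fun a b => ⟨fun hb => ?_, fun ⟨i, hi⟩ => (he' i a b hi).2⟩, ?_⟩
  · have hev : ∀ f : ℕ → ℕ, Primrec f →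
        Primrec fun i : ℕ => c.evaln (f i.unpair.1) i.unpair.2 := fun f hf =>
      Nat.Partrec.Code.primrec_evaln.comp (((hf.comp (Primrec.fst.comp Primrec.unpair)).pair
        (Primrec.const c)).pair (Primrec.snd.comp Primrec.unpair))
    have hn : Primrec fun o : Option ℕ => o.isNone :=
      (Primrec.not.comp Primrec.option_isSome).of_eq fun o => by cases o <;> rfl
    exact (Primrec.cond (hn.comp (hev _ Primrec.id))
      (Primrec.option_bind (hev _ Primrec.succ) (Primrec.decode.comp Primrec.snd).to₂)
      (Primrec.const none)).to_comp
  · have hm : encode (a, b) ∈ c.eval (encode a) := (hmem _ _).2 ⟨a, b, rfl, hb, rfl⟩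
    have hex : ∃ k, encode (a, b) ∈ c.evaln k (encode a) := Nat.Partrec.Code.evaln_complete.1 hm
    classical
    obtain ⟨k, hk, hmin⟩ : ∃ k, encode (a, b) ∈ c.evaln (k + 1) (encode a) ∧
        c.evaln k (encode a) = none := by
      have hs := Nat.find_spec hex
      rcases hk : Nat.find hex with _ | k
      · rw [hk] at hs; simp [Nat.Partrec.Code.evaln] at hs
      · rw [hk] at hs
        refine ⟨k, hs, ?_⟩
        have hnot := Nat.find_min hex (m := k) (by omega)
        cases h : c.evaln k (encode a) with
        | none => rfl
        | some m =>
          have h1 := Nat.Partrec.Code.evaln_mono (Nat.le_succ k) h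
          have h2 := Option.mem_unique h1 hs
          exact absurd (h2 ▸ h) hnot
    refine ⟨Nat.pair k (encode a), (he _ _).2 ?_⟩
    simp only [Nat.unpair_pair]
    exact ⟨hmin, _, hk, encodek _⟩
  · intro i j a b b' hi hj
    have h2 : i.unpair.2 = j.unpair.2 := (he' _ _ _ hi).1.trans (he' _ _ _ hj).1.symm
    obtain ⟨hi0, m, him, -⟩ := (he _ _).1 hi
    obtain ⟨hj0, m', hjm, -⟩ := (he _ _).1 hj
    have key : ∀ {k k' n m}, c.evaln (k + 1) n = some m → c.evaln k' n = none → k' ≤ k := by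
      intro k k' n m h h'
      by_contra hlt
      have := Nat.Partrec.Code.evaln_mono (show k + 1 ≤ k' by omega) h
      rw [h'] at this
      cases this
    rw [h2] at him hi0
    rw [← Nat.pair_unpair i, ← Nat.pair_unpair j, h2, le_antisymm (key hjm hi0) (key him hj0)]

/-! ### Exact dyadic arithmetic for sums of weights -/

theorem Primrec.nat_pow : Primrec₂ ((· ^ ·) : ℕ → ℕ → ℕ) :=
  Primrec₂.unpaired'.1 Nat.Primrec.pow

/-- The weight `2^{-l}` of a codeword length `l`, and `0` if there is no codeword. -/
noncomputable def codeWeight (o : Option ℕ) : ℝ :=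
  o.elim 0 fun l => (1 / 2) ^ l

theorem codeWeight_nonneg (o : Option ℕ) : 0 ≤ codeWeight o := by
  cases o <;> simp [codeWeight]

/-- The sum of the weights of the first `i` lengths in `g`, as a fraction `a / 2^e` given by the
pair `(a, e)`. -/
def dyadicSum (g : ℕ → Option ℕ) (i : ℕ) : ℕ × ℕ :=
  Nat.rec (0, 0) (fun j s => (g j).elim s fun l => (s.1 * 2 ^ l + 2 ^ s.2, s.2 + l)) i

/-- Links the real sums used in the estimates with the integer pairs that a machine can compute. -/
theorem sum_codeWeight_eq_dyadicSum (g : ℕ → Option ℕ) (i : ℕ) :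
    ∑ j ∈ Finset.range i, codeWeight (g j) = (dyadicSum g i).1 / 2 ^ (dyadicSum g i).2 := by
  induction i with
  | zero => simp [dyadicSum]
  | succ i ih =>
    have hs : dyadicSum g (i + 1) = (g i).elim (dyadicSum g i) fun l =>
      ((dyadicSum g i).1 * 2 ^ l + 2 ^ (dyadicSum g i).2, (dyadicSum g i).2 + l) := rfl
    rw [Finset.sum_range_succ, ih, hs]
    cases g i with
    | none => simp [codeWeight]
    | some l =>
      simp only [codeWeight, Option.elim_some]
      push_cast
      rw [pow_add, one_div, inv_pow]
      field_simp

theorem computable_dyadicSum {α : Type*} [Primcodable α] {g : α → ℕ → Option ℕ}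
    (hg : Computable₂ g) : Computable₂ fun a i => dyadicSum (g a) i := by
  have hstep : Primrec₂ fun (s : ℕ × ℕ) (l : ℕ) => (s.1 * 2 ^ l + 2 ^ s.2, s.2 + l) := by
    have hp : ∀ {f : (ℕ × ℕ) × ℕ → ℕ}, Primrec f → Primrec fun p => 2 ^ f p :=
      fun hf => Primrec.nat_pow.comp (Primrec.const 2) hf
    exact (Primrec.nat_add.comp
      (Primrec.nat_mul.comp (Primrec.fst.comp Primrec.fst) (hp Primrec.snd))
      (hp (Primrec.snd.comp Primrec.fst))).pair
      (Primrec.nat_add.comp (Primrec.snd.comp Primrec.fst) Primrec.snd)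
  have h : Computable fun q : α × ℕ => (Nat.rec (0, 0)
      (fun j s => Option.casesOn (g q.1 j) s fun l => (s.1 * 2 ^ l + 2 ^ s.2, s.2 + l)) q.2 :
        ℕ × ℕ) := by
    refine Computable.nat_rec (h := fun (q : α × ℕ) (p : ℕ × ℕ × ℕ) =>
      Option.casesOn (g q.1 p.1) p.2 fun l => (p.2.1 * 2 ^ l + 2 ^ p.2.2, p.2.2 + l))
      Computable.snd (Computable.const _) ?_
    refine Computable.option_casesOn (f := fun r : (α × ℕ) × (ℕ × ℕ × ℕ) => r.2.2)
      (hg.comp (Computable.fst.comp Computable.fst) (Computable.fst.comp Computable.snd))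
      (Computable.snd.comp Computable.snd) ?_
    exact hstep.to_comp.comp
      (Computable.snd.comp (Computable.snd.comp Computable.fst)) Computable.snd
  refine h.of_eq fun q => ?_
  unfold dyadicSum
  congr 1
  funext j s
  cases g q.1 j <;> rfl

/-! ### Strings as binary numbers -/

/-- The number with a given binary expansion, most significant bit first. -/
def bitsValue (q : List Bool) : ℕ :=
  q.foldl (fun a b => 2 * a + b.toNat) 0

theorem bitsValue_concat (q : List Bool) (b : Bool) :
    bitsValue (q ++ [b]) = 2 * bitsValue q + b.toNat := by
  simp [bitsValue]

/-- Removing trailing bits is integer division by a power of two. This turns the test for being a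
prefix of a codeword into arithmetic. -/
theorem bitsValue_div (q t : List Bool) : bitsValue (q ++ t) / 2 ^ t.length = bitsValue q := by
  induction t using List.reverseRecOn with
  | nil => simp
  | append_singleton t b ih =>
    rw [← List.append_assoc, bitsValue_concat, List.length_append, List.length_singleton,
      pow_succ', ← Nat.div_div_eq_div_mul, ← ih]
    congr 1
    cases b
    · simp
    · simp; omega

theorem exists_bitsValue (n v : ℕ) (h : v < 2 ^ n) : ∃ p, p.length = n ∧ bitsValue p = v := by
  induction n generalizing v with
  | zero => exact ⟨[], rfl, by simpa [bitsValue] using (Nat.lt_one_iff.1 h).symm⟩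
  | succ n ih =>
    obtain ⟨p, hp, hv⟩ := ih (v / 2) (by rw [pow_succ] at h; omega)
    refine ⟨p ++ [decide (v % 2 = 1)], by simp [hp], ?_⟩
    rw [bitsValue_concat, hv]
    rcases Nat.mod_two_eq_zero_or_one v with h | h <;> (simp [h]; omega)

theorem computable_bitsValue : Computable bitsValue := by
  have hb : Primrec Bool.toNat := Primrec.dom_finite _
  refine (Primrec.list_foldl (f := fun q : List Bool => q) (g := fun _ => 0)
    (h := fun _ p => 2 * p.1 + p.2.toNat) Primrec.id (Primrec.const 0) ?_).to_comp
  exact Primrec.nat_add.comp (Primrec.nat_mul.comp (Primrec.const 2)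
    (Primrec.fst.comp Primrec.snd)) (hb.comp (Primrec.snd.comp Primrec.snd))

/-! ### The Kraft–Chaitin construction -/

/-- The number of the codeword that the greedy allocation gives to a request for length `l` when
the fraction `s.1 / 2^{s.2}` of the unit interval is used up. The codeword has length `l + 1`. -/
def greedyCode (s : ℕ × ℕ) (l : ℕ) : ℕ :=
  s.1 * 2 ^ (l + 1) / 2 ^ s.2 + 1

/-- Any stretch of length `2^{-l}` contains an aligned dyadic cell of half that length: round the
left end down to the grid of step `2^{-(l+1)}` and move one cell to the right. Giving up one bit of
codeword length thus allows requests to be served in order of arrival, each inside its own stretch.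
-/
theorem greedyCode_bounds (s : ℕ × ℕ) (l : ℕ) :
    (s.1 / 2 ^ s.2 : ℝ) < greedyCode s l / 2 ^ (l + 1) ∧
      ((greedyCode s l + 1) / 2 ^ (l + 1) : ℝ) ≤ s.1 / 2 ^ s.2 + (1 / 2) ^ l := by
  have h2 : (0 : ℝ) < 2 ^ s.2 := by positivity
  have h3 : (0 : ℝ) < 2 ^ (l + 1) := by positivity
  have h1 : s.1 * 2 ^ (l + 1) < greedyCode s l * 2 ^ s.2 := by
    rw [greedyCode]
    exact Nat.lt_mul_of_div_lt (Nat.lt_succ_self _) (by positivity)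
  have h4 : (greedyCode s l - 1) * 2 ^ s.2 ≤ s.1 * 2 ^ (l + 1) := by
    simpa [greedyCode] using Nat.div_mul_le_self (s.1 * 2 ^ (l + 1)) (2 ^ s.2)
  have hpos : 1 ≤ greedyCode s l := by simp [greedyCode]
  have h1' : (s.1 * 2 ^ (l + 1) : ℝ) < greedyCode s l * 2 ^ s.2 := by exact_mod_cast h1
  have h4' : ((greedyCode s l - 1) * 2 ^ s.2 : ℝ) ≤ s.1 * 2 ^ (l + 1) := by
    have := (Nat.cast_le (α := ℝ)).2 h4
    push_cast [Nat.cast_sub hpos] at this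
    exact this
  constructor
  · rw [div_lt_div_iff₀ h2 h3]
    exact h1'
  · have e : (s.1 / 2 ^ s.2 + (1 / 2) ^ l : ℝ) =
        (s.1 * 2 ^ (l + 1) / 2 ^ s.2 + 2) / 2 ^ (l + 1) := by
      rw [one_div, inv_pow, pow_succ]
      field_simp
    rw [e]
    have := (le_div_iff₀ h2).2 h4'
    exact div_le_div_of_nonneg_right (by linarith) h3.le

/-- What the requests `f` (a codeword length and an output each) tell a machine that has scanned
`q`: if `q` is a prefix of the codeword of request `i`, then to halt with the output of the request
when `q` is the whole codeword, and to go on otherwise. -/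
def greedyAnswer (f : ℕ → Option (ℕ × List Bool)) (q : List Bool) (i : ℕ) :
    Option (Option (List Bool)) :=
  (f i).bind fun r =>
    bif decide (q.length ≤ r.1 + 1) &&
      decide (greedyCode (dyadicSum (fun j => (f j).map Prod.fst) i) r.1 /
        2 ^ (r.1 + 1 - q.length) = bitsValue q) then
      some (bif decide (q.length = r.1 + 1) then some r.2 else none)
    else none

theorem computable_greedyAnswer {α : Type*} [Primcodable α]
    {f : α → ℕ → Option (ℕ × List Bool)} (hf : Computable₂ f) :
    Computable₂ fun (a : α × List Bool) i => greedyAnswer (f a.1) a.2 i := by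
  have hcode : Primrec₂ greedyCode := by
    refine Primrec.succ.comp (Primrec.nat_div.comp (Primrec.nat_mul.comp
      (Primrec.fst.comp Primrec.fst) (Primrec.nat_pow.comp (Primrec.const 2)
        (Primrec.succ.comp Primrec.snd)))
      (Primrec.nat_pow.comp (Primrec.const 2) (Primrec.snd.comp Primrec.fst)))
  have hd : Computable₂ fun (a : α) i => dyadicSum (fun j => (f a j).map Prod.fst) i :=
    computable_dyadicSum (Computable.option_map hf (Computable.fst.comp Computable.snd).to₂)
  let ρ := ((α × List Bool) × ℕ) × (ℕ × List Bool)
  have ha : Computable fun p : ρ => p.1.1.1 :=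
    Computable.fst.comp (Computable.fst.comp Computable.fst)
  have hq : Computable fun p : ρ => p.1.1.2 :=
    Computable.snd.comp (Computable.fst.comp Computable.fst)
  have hi : Computable fun p : ρ => p.1.2 := Computable.snd.comp Computable.fst
  have hl : Computable fun p : ρ => p.2.1 := Computable.fst.comp Computable.snd
  have hx : Computable fun p : ρ => p.2.2 := Computable.snd.comp Computable.snd
  have hql : Computable fun p : ρ => p.1.1.2.length := Computable.list_length.comp hq
  have hl1 : Computable fun p : ρ => p.2.1 + 1 := Computable.succ.comp hl
  have hv := Primrec.nat_div.to_comp.comp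
    (hcode.to_comp.comp (hd.comp ha hi) hl) (Primrec.nat_pow.to_comp.comp (Computable.const 2)
      (Primrec.nat_sub.to_comp.comp hl1 hql))
  refine Computable.option_bind (hf.comp (Computable.fst.comp Computable.fst) Computable.snd) ?_
  refine Computable.cond (Primrec.and.to_comp.comp (Primrec.nat_le.decide.to_comp.comp hql hl1)
    (Primrec.eq.decide.to_comp.comp hv (computable_bitsValue.comp hq))) ?_ (Computable.const none)
  exact Computable.option_some.comp (Computable.cond
    (Primrec.eq.decide.to_comp.comp hql hl1) (Computable.option_some.comp hx)
    (Computable.const none))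

theorem greedyAnswer_eq_some {f : ℕ → Option (ℕ × List Bool)} {q : List Bool} {i : ℕ}
    {o : Option (List Bool)} :
    greedyAnswer f q i = some o ↔ ∃ l x, f i = some (l, x) ∧ q.length ≤ l + 1 ∧
      greedyCode (dyadicSum (fun j => (f j).map Prod.fst) i) l / 2 ^ (l + 1 - q.length) =
        bitsValue q ∧ (if q.length = l + 1 then some x else none) = o := by
  unfold greedyAnswer
  rcases f i with _ | ⟨l, x⟩
  · simp
  · simp only [Option.bind_some, Option.some.injEq, Prod.mk.injEq, Bool.cond_eq_ite,
      Bool.and_eq_true, decide_eq_true_eq]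
    constructor
    · intro h
      split_ifs at h with h1 h2
      · exact ⟨l, x, ⟨rfl, rfl⟩, h1.1, h1.2, by simpa [h2] using h⟩
      · exact ⟨l, x, ⟨rfl, rfl⟩, h1.1, h1.2, by simpa [h2] using h⟩
    · rintro ⟨_, _, ⟨rfl, rfl⟩, h1, h2, rfl⟩
      rw [if_pos ⟨h1, h2⟩]

/-- Different requests get codewords none of which extends the other. -/
theorem greedyCode_div_ne {g : ℕ → Option ℕ} {i j l m : ℕ} (hi : g i = some l)
    (hj : g j = some m) (hij : i ≠ j) (hml : m ≤ l) :
    greedyCode (dyadicSum g i) l / 2 ^ (l - m) ≠ greedyCode (dyadicSum g j) m := by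
  intro h
  obtain ⟨a1, a2⟩ := greedyCode_bounds (dyadicSum g i) l
  obtain ⟨b1, b2⟩ := greedyCode_bounds (dyadicSum g j) m
  have step : ∀ {i l}, g i = some l →
      ((dyadicSum g i).1 / 2 ^ (dyadicSum g i).2 + (1 / 2) ^ l : ℝ) =
        (dyadicSum g (i + 1)).1 / 2 ^ (dyadicSum g (i + 1)).2 := by
    intro i l h
    rw [← sum_codeWeight_eq_dyadicSum, ← sum_codeWeight_eq_dyadicSum, Finset.sum_range_succ, h]
    simp [codeWeight]
  have mono : ∀ {i j}, i ≤ j → ((dyadicSum g i).1 / 2 ^ (dyadicSum g i).2 : ℝ) ≤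
      (dyadicSum g j).1 / 2 ^ (dyadicSum g j).2 := by
    intro i j h
    rw [← sum_codeWeight_eq_dyadicSum, ← sum_codeWeight_eq_dyadicSum]
    exact Finset.sum_le_sum_of_subset_of_nonneg (Finset.range_mono h)
      fun _ _ _ => codeWeight_nonneg _
  rw [step hi] at a2
  rw [step hj] at b2
  set v := greedyCode (dyadicSum g i) l
  set w := greedyCode (dyadicSum g j) m
  have hpow : (2 : ℝ) ^ (l + 1) = 2 ^ (l - m) * 2 ^ (m + 1) := by
    rw [← pow_add]; congr 1; omega
  -- By `c1` and `c2`, under `h` the cell of `i` starts inside the cell of `j`. But the two cells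
  -- lie in the stretches between consecutive partial sums belonging to `i` and `j`, which do not
  -- overlap.
  have c1 : (w / 2 ^ (m + 1) : ℝ) ≤ v / 2 ^ (l + 1) := by
    have : w * 2 ^ (l - m) ≤ v := by rw [← h]; exact Nat.div_mul_le_self _ _
    have : (w * 2 ^ (l - m) : ℝ) ≤ v := by exact_mod_cast this
    rw [hpow, div_le_div_iff₀ (by positivity) (by positivity), ← mul_assoc]
    exact mul_le_mul_of_nonneg_right this (by positivity)
  have c2 : (v / 2 ^ (l + 1) : ℝ) < (w + 1) / 2 ^ (m + 1) := by
    have : v < (w + 1) * 2 ^ (l - m) := by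
      rw [← h]; exact Nat.lt_mul_of_div_lt (Nat.lt_succ_self _) (by positivity)
    have : (v : ℝ) < (w + 1) * 2 ^ (l - m) := by exact_mod_cast this
    rw [hpow, div_lt_div_iff₀ (by positivity) (by positivity), ← mul_assoc]
    exact mul_lt_mul_of_pos_right this (by positivity)
  have c3 : (v / 2 ^ (l + 1) : ℝ) < (v + 1) / 2 ^ (l + 1) :=
    div_lt_div_of_pos_right (by linarith) (by positivity)
  rcases lt_or_gt_of_ne hij with hlt | hlt
  · have := mono (Nat.succ_le_of_lt hlt)
    linarith
  · have := mono (Nat.succ_le_of_lt hlt)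
    linarith

/-- A machine that serves a computable sequence of requests, each for a codeword length and an
output, if the sum of the requested weights is at most `1`. The requests may depend on a value that
is computed from the auxiliary information. -/
theorem exists_machine_of_requests {α : Type*} [Primcodable α]
    {f : α → ℕ → Option (ℕ × List Bool)} (hf : Computable₂ f) {g : List Bool →. α}
    (hg : Partrec g) :
    ∃ T : SelfDelimitingMachine, ∀ y a, a ∈ g y →
      (∀ N, ∑ i ∈ Finset.range N, codeWeight ((f a i).map Prod.fst) ≤ 1) →
      ∀ i l x, f a i = some (l, x) → ∃ p : List Bool, p.length = l + 1 ∧ T.Outputs p y x := by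
  -- Having scanned `q`, search for any request whose codeword extends `q`; if there is none, run
  -- forever.
  let control : List Bool → List Bool →. Option (List Bool) := fun q y =>
    (g y).bind fun a => Nat.rfindOpt (greedyAnswer (f a) q)
  have hcontrol : Partrec₂ control := by
    have hF : Computable fun z : (α × List Bool) × ℕ => greedyAnswer (f z.1.1) z.1.2 z.2 :=
      computable_greedyAnswer hf
    have hr : Computable fun r : ((List Bool × List Bool) × α) × ℕ => ((r.1.2, r.1.1.1), r.2) :=
      ((Computable.snd.comp Computable.fst).pair (Computable.fst.comp
        (Computable.fst.comp Computable.fst))).pair Computable.snd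
    have hG : Computable₂ fun (r : (List Bool × List Bool) × α) i =>
      greedyAnswer (f r.2) r.1.1 i := by
      have h := hF.comp hr
      exact h.to₂
    have hb : Partrec fun z : (List Bool × List Bool) × α =>
      Nat.rfindOpt (greedyAnswer (f z.2) z.1.1) := Partrec.rfindOpt hG
    have hg' : Partrec fun z : List Bool × List Bool => g z.2 := hg.comp Computable.snd
    exact hg'.bind hb.to₂
  refine ⟨⟨control, hcontrol⟩, fun y a ha hsum i l x hi => ?_⟩
  set G : ℕ → Option ℕ := fun j => (f a j).map Prod.fst with hG
  have hGi : G i = some l := by simp [hG, hi]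
  -- The cell of request `i` ends no later than the partial sum up to and including `i`, hence
  -- inside the unit interval.
  have hlt : greedyCode (dyadicSum G i) l < 2 ^ (l + 1) := by
    have h1 := (greedyCode_bounds (dyadicSum G i) l).2
    have h2 := hsum (i + 1)
    have h3 : codeWeight (G i) = (1 / 2) ^ l := by simp [hGi, codeWeight]
    rw [Finset.sum_range_succ, sum_codeWeight_eq_dyadicSum, h3] at h2
    have h4 := h1.trans h2
    rw [div_le_one (by positivity)] at h4
    exact_mod_cast h4
  obtain ⟨p, hp, hv⟩ := exists_bitsValue _ _ hlt
  have key : ∀ q, q <+: p → (if q = p then some x else none) ∈ control q y := by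
    rintro q ⟨t, rfl⟩
    rw [List.length_append] at hp
    have hdiv : greedyCode (dyadicSum G i) l / 2 ^ (l + 1 - q.length) = bitsValue q := by
      rw [← hv, ← hp, Nat.add_sub_cancel_left, bitsValue_div]
    have hans := greedyAnswer_eq_some.2 ⟨l, x, hi, by omega, hdiv, rfl⟩
    refine Part.mem_bind ha ?_
    obtain ⟨o, ho⟩ := Part.dom_iff_mem.1 (Nat.rfindOpt_dom.2 ⟨i, _, hans⟩)
    obtain ⟨j, hj⟩ := Nat.rfindOpt_spec ho
    obtain ⟨m, z, hfj, hqm, hdivj, rfl⟩ := greedyAnswer_eq_some.1 hj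
    have hGj : G j = some m := by simp [hG, hfj]
    have hqt : q = q ++ t ↔ q.length = l + 1 := by
      rw [List.self_eq_append_right, ← List.length_eq_zero_iff]; omega
    simp only [hqt]
    by_cases hij : i = j
    · subst hij
      obtain ⟨rfl, rfl⟩ := Prod.mk.inj (Option.some.inj (hi.symm.trans hfj))
      exact ho
    -- The search may stop at another request `j` whose codeword also extends `q`. Then `q` is the
    -- whole codeword of neither, since codewords are prefix-free, and both requests give the answer
    -- "go on".
    · have hq1 : q.length ≠ m + 1 := by
        intro h
        rw [h] at hdiv hdivj
        simp only [Nat.sub_self, pow_zero, Nat.div_one] at hdivj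
        refine greedyCode_div_ne hGi hGj hij (by omega) ?_
        rw [show l - m = l + 1 - (m + 1) by omega, hdiv]
        exact hdivj.symm
      have hq2 : q.length ≠ l + 1 := by
        intro h
        rw [h] at hdiv hdivj
        simp only [Nat.sub_self, pow_zero, Nat.div_one] at hdiv
        refine greedyCode_div_ne hGj hGi (Ne.symm hij) (by omega) ?_
        rw [show m - l = m + 1 - (l + 1) by omega]
        exact hdivj.trans hdiv.symm
      rw [if_neg hq1] at ho
      rwa [if_neg hq2]
  refine ⟨p, hp, fun q hq hne => ?_, ?_⟩
  · simpa [hne] using key q hq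
  · simpa using key p List.prefix_rfl

/-! ### Scanning and the output function -/

namespace SelfDelimitingMachine

/-- The number of bits that `T` scans on the tape `q` until it halts, or `|q| + 1` if it asks for a
bit beyond `q`. -/
def scan (T : SelfDelimitingMachine) (q y : List Bool) : Part ℕ :=
  Nat.rfind fun n => bif decide (n ≤ q.length) then (T.control (q.take n) y).map Option.isSome
    else Part.some true

theorem partrec_scan (T : SelfDelimitingMachine) : Partrec₂ T.scan := by
  refine Partrec.rfind (p := fun (a : List Bool × List Bool) n =>
    bif decide (n ≤ a.1.length) then (T.control (a.1.take n) a.2).map Option.isSome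
    else Part.some true) ?_
  refine Partrec.cond ?_ ?_ (Computable.const true).partrec
  · exact (Primrec.nat_le.decide.comp Primrec.snd
      (Primrec.list_length.comp (Primrec.fst.comp Primrec.fst))).to_comp
  · refine Partrec.map (T.computable.comp
      (Primrec.list_take.comp Primrec.snd (Primrec.fst.comp Primrec.fst)).to_comp
      (Computable.snd.comp Computable.fst)) ?_
    exact (Primrec.option_isSome.to_comp.comp Computable.snd).to₂

variable {T : SelfDelimitingMachine} {p q y x : List Bool}

theorem mem_scan_of_none (h : ∀ s, s <+: q → none ∈ T.control s y) :
    q.length + 1 ∈ T.scan q y := by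
  refine Nat.mem_rfind.2 ⟨by simp, fun {m} hm => ?_⟩
  have : m ≤ q.length := by omega
  simp only [this, decide_true, cond_true]
  exact (Part.mem_map_iff _).2 ⟨none, h _ (List.take_prefix m q), rfl⟩

theorem Outputs.mem_scan (h : T.Outputs p y x) (t : List Bool) : p.length ∈ T.scan (p ++ t) y := by
  refine Nat.mem_rfind.2 ⟨?_, fun {m} hm => ?_⟩
  · simpa using (Part.mem_map_iff Option.isSome).2 ⟨_, h.2, rfl⟩
  · have h1 : m ≤ (p ++ t).length := by simp; omega
    have h2 : (p ++ t).take m = p.take m := by rw [List.take_append_of_le_length hm.le]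
    simp only [h1, decide_true, cond_true, h2]
    refine (Part.mem_map_iff _).2 ⟨none, h.1 _ (List.take_prefix m p) ?_, rfl⟩
    intro h'
    have := congrArg List.length h'
    simp at this
    omega

theorem Outputs.of_mem_scan (h : p.length ∈ T.scan p y) (hx : some x ∈ T.control p y) :
    T.Outputs p y x := by
  refine ⟨fun q hq hne => ?_, hx⟩
  obtain ⟨-, hmin⟩ := Nat.mem_rfind.1 h
  have hlt : q.length < p.length := by
    rcases hq.length_le.lt_or_eq with h | h
    · exact h
    · exact absurd (hq.eq_of_length h) hne
  have h1 := hmin hlt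
  simp only [hlt.le, decide_true, cond_true, ← List.prefix_iff_eq_take.1 hq] at h1
  obtain ⟨o, ho, hs⟩ := (Part.mem_map_iff _).1 h1
  cases o with
  | none => exact ho
  | some _ => simp at hs

/-- The output function of a machine. -/
def output (T : SelfDelimitingMachine) (p y : List Bool) : Part (List Bool) :=
  (T.scan p y).bind fun n => (T.control p y).bind fun o =>
    -- The test on `n` discards values of `control` at strings `p` that the machine never reaches
    -- because it halts on a proper prefix.
    Part.ofOption (bif decide (n = p.length) then o else none)

theorem partrec_output (T : SelfDelimitingMachine) : Partrec₂ T.output := by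
  refine Partrec.bind T.partrec_scan (Partrec.bind (T.computable.comp
    (Computable.fst.comp Computable.fst) (Computable.snd.comp Computable.fst)) ?_)
  refine Computable.ofOption (Computable.cond ?_ Computable.snd (Computable.const none))
  exact Primrec.eq.decide.to_comp.comp (Computable.snd.comp Computable.fst)
    (Computable.list_length.comp (Computable.fst.comp (Computable.fst.comp Computable.fst)))

theorem mem_output_iff : x ∈ T.output p y ↔ T.Outputs p y x := by
  constructor
  · intro h
    obtain ⟨n, hn, h⟩ := Part.mem_bind_iff.1 h
    obtain ⟨o, ho, h⟩ := Part.mem_bind_iff.1 h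
    by_cases hp : n = p.length
    · subst hp
      have : o = some x := by simpa using h
      exact .of_mem_scan hn (this ▸ ho)
    · simp [hp] at h
  · intro h
    refine Part.mem_bind (a := p.length) (by simpa using h.mem_scan []) (Part.mem_bind h.2 ?_)
    simp

/-- Programs for fixed auxiliary information are prefix-free: a machine cannot both halt at `p` and
ask for a further bit there. -/
theorem Outputs.eq_of_prefix {x' : List Bool} (hp : T.Outputs p y x) (hq : T.Outputs q y x')
    (h : p <+: q) : p = q := by
  by_contra hne
  have := Part.mem_unique (hq.1 p h hne) hp.2
  cases this

end SelfDelimitingMachine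

/-! ### Kraft's inequality -/

open InformationTheory in
/-- Kraft's inequality for prefix-free sets of strings. -/
theorem sum_pow_length_le_one_of_prefixFree {S : Finset (List Bool)}
    (hS : ∀ p ∈ S, ∀ q ∈ S, p <+: q → p = q) : ∑ w ∈ S, (1 / 2 : ℝ) ^ w.length ≤ 1 := by
  -- A code containing the empty word is not uniquely decodable, so Kraft–McMillan does not apply;
  -- but then prefix-freeness leaves no other word.
  by_cases h0 : [] ∈ S
  · have : S = {[]} := Finset.eq_singleton_iff_unique_mem.2
      ⟨h0, fun q hq => (hS [] h0 q hq List.nil_prefix).symm⟩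
    simp [this]
  · have hud : UniquelyDecodable (S : Set (List Bool)) := by
      intro L₁
      induction L₁ with
      | nil =>
        rintro (_ | ⟨w, L₂⟩) - h2 h
        · rfl
        · have hw : w = [] := by simp at h; exact h.1
          exact absurd (hw ▸ h2 w (by simp)) h0
      | cons w L₁ ih =>
        rintro (_ | ⟨w', L₂⟩) h1 h2 h
        · have hw : w = [] := by simp at h; exact h.1
          exact absurd (hw ▸ h1 w (by simp)) h0
        · have hw : w ∈ S := h1 w (by simp)
          have hw' : w' ∈ S := h2 w' (by simp)
          rw [List.flatten_cons, List.flatten_cons] at h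
          have heq : w = w' := by
            rcases List.prefix_or_prefix_of_prefix (List.prefix_append w L₁.flatten)
              (h ▸ List.prefix_append w' L₂.flatten) with hp | hp
            · exact hS _ hw _ hw' hp
            · exact (hS _ hw' _ hw hp).symm
          subst heq
          rw [ih L₂ (fun v hv => h1 v (by simp [hv])) (fun v hv => h2 v (by simp [hv]))
            (List.append_cancel_left h)]
    simpa using kraft_mcmillan_inequality hud

/-! ### The coding theorem -/

/-- The least `k` with `2^{-k} ≤ s.1 / 2^{s.2}`, for a positive fraction that is at most `1`. -/
def dyadicLevel (s : ℕ × ℕ) : ℕ :=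
  s.2 - Nat.findGreatest (fun j => 2 ^ j ≤ s.1) s.2

theorem dyadicLevel_bounds {s : ℕ × ℕ} (h0 : s.1 ≠ 0) (h1 : s.1 ≤ 2 ^ s.2) :
    ((1 / 2) ^ dyadicLevel s : ℝ) ≤ s.1 / 2 ^ s.2 ∧
      (s.1 / 2 ^ s.2 : ℝ) < 2 * (1 / 2) ^ dyadicLevel s := by
  have hle : Nat.findGreatest (fun j => 2 ^ j ≤ s.1) s.2 ≤ s.2 := Nat.findGreatest_le _
  have hspec : 2 ^ Nat.findGreatest (fun j => 2 ^ j ≤ s.1) s.2 ≤ s.1 :=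
    Nat.findGreatest_spec (P := fun j => 2 ^ j ≤ s.1) (Nat.zero_le _)
      (by simpa using Nat.one_le_iff_ne_zero.2 h0)
  have hlt : s.1 < 2 ^ (Nat.findGreatest (fun j => 2 ^ j ≤ s.1) s.2 + 1) := by
    rcases hle.lt_or_eq with h | h
    · exact not_le.1 (Nat.findGreatest_is_greatest (P := fun j => 2 ^ j ≤ s.1)
        (Nat.lt_succ_self _) h)
    · rw [h]
      exact h1.trans_lt (Nat.pow_lt_pow_right (by norm_num) (Nat.lt_succ_self _))
  unfold dyadicLevel
  set g := Nat.findGreatest (fun j => 2 ^ j ≤ s.1) s.2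
  have hpow : ((1 / 2) ^ (s.2 - g) : ℝ) = 2 ^ g / 2 ^ s.2 := by
    have : (2 : ℝ) ^ s.2 = 2 ^ (s.2 - g) * 2 ^ g := by rw [← pow_add]; congr 1; omega
    rw [this, one_div, inv_pow]
    field_simp
  rw [hpow, ← mul_div_assoc]
  constructor
  · gcongr
    exact_mod_cast hspec
  · gcongr
    rw [← pow_succ']
    exact_mod_cast hlt

/-- The length requested, on the arrival of the `i`-th length in `g`, for a string whose programs
have the lengths in `g`: one more than the level of the sum of their weights, if that has gone
down. -/
def levelRequest (g : ℕ → Option ℕ) (i : ℕ) : Option ℕ :=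
  (g i).bind fun _ =>
    bif decide ((dyadicSum g i).1 = 0) ||
      decide (dyadicLevel (dyadicSum g (i + 1)) < dyadicLevel (dyadicSum g i)) then
      some (dyadicLevel (dyadicSum g (i + 1)) + 1)
    else none

/-- When the level drops from `d'` to `d < d'`, the earlier requests weigh at most `2^{-d'} ≤
2^{-(d+1)}` and the new one weighs `2^{-(d+1)}`, together at most `2^{-d}`. The "one more" in the
requested length is what makes this induction close. -/
theorem levelRequest_spec {g : ℕ → Option ℕ}
    (hg : ∀ N, ∑ i ∈ Finset.range N, codeWeight (g i) ≤ 1) (N : ℕ) :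
    (∑ i ∈ Finset.range N, codeWeight (levelRequest g i) ≤
      if (dyadicSum g N).1 = 0 then 0 else (1 / 2) ^ dyadicLevel (dyadicSum g N)) ∧
    ((dyadicSum g N).1 ≠ 0 →
      ∃ i, levelRequest g i = some (dyadicLevel (dyadicSum g N) + 1)) := by
  have hle : ∀ N, (dyadicSum g N).1 ≤ 2 ^ (dyadicSum g N).2 := by
    intro N
    have h := hg N
    rw [sum_codeWeight_eq_dyadicSum, div_le_one (by positivity)] at h
    exact_mod_cast h
  induction N with
  | zero => simp [dyadicSum]
  | succ N ih =>
    obtain ⟨ih1, ih2⟩ := ih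
    have hs : dyadicSum g (N + 1) = (g N).elim (dyadicSum g N) fun l =>
      ((dyadicSum g N).1 * 2 ^ l + 2 ^ (dyadicSum g N).2, (dyadicSum g N).2 + l) := rfl
    cases hN : g N with
    | none =>
      have hr : levelRequest g N = none := by simp [levelRequest, hN]
      rw [hN, Option.elim_none] at hs
      rw [Finset.sum_range_succ, hr, hs]
      rw [show codeWeight none = 0 from rfl, add_zero]
      exact ⟨ih1, ih2⟩
    | some l =>
      have hpos : (dyadicSum g (N + 1)).1 ≠ 0 := by
        rw [hs, hN]
        simp
      have hb := dyadicLevel_bounds hpos (hle _)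
      have hr : levelRequest g N = if (dyadicSum g N).1 = 0 ∨
          dyadicLevel (dyadicSum g (N + 1)) < dyadicLevel (dyadicSum g N) then
          some (dyadicLevel (dyadicSum g (N + 1)) + 1) else none := by
        simp [levelRequest, hN, Bool.cond_eq_ite]
      rw [Finset.sum_range_succ, hr, if_neg hpos]
      split_ifs with hc
      · refine ⟨?_, fun _ => ⟨N, by rw [hr, if_pos hc]⟩⟩
        have hhalf : (∑ i ∈ Finset.range N, codeWeight (levelRequest g i)) ≤
            (1 / 2) ^ (dyadicLevel (dyadicSum g (N + 1)) + 1) := by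
          refine ih1.trans ?_
          split_ifs with h0
          · positivity
          · exact pow_le_pow_of_le_one (by norm_num) (by norm_num)
              (Nat.succ_le_of_lt (hc.resolve_left h0))
        rw [show codeWeight (some (dyadicLevel (dyadicSum g (N + 1)) + 1)) =
          (1 / 2) ^ (dyadicLevel (dyadicSum g (N + 1)) + 1) from rfl]
        rw [pow_succ] at hhalf ⊢
        linarith
      · push Not at hc
        obtain ⟨h0, hge⟩ := hc
        have ha := dyadicLevel_bounds h0 (hle _)
        have hmono : ((dyadicSum g N).1 / 2 ^ (dyadicSum g N).2 : ℝ) ≤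
            (dyadicSum g (N + 1)).1 / 2 ^ (dyadicSum g (N + 1)).2 := by
          rw [← sum_codeWeight_eq_dyadicSum, ← sum_codeWeight_eq_dyadicSum,
            Finset.sum_range_succ]
          linarith [codeWeight_nonneg (g N)]
        -- The sum has not decreased, so its level cannot have gone up.
        have heq : dyadicLevel (dyadicSum g (N + 1)) = dyadicLevel (dyadicSum g N) := by
          refine le_antisymm ?_ hge
          by_contra hlt
          have h1 : ((1 / 2) ^ dyadicLevel (dyadicSum g (N + 1)) : ℝ) ≤
              (1 / 2) ^ (dyadicLevel (dyadicSum g N) + 1) :=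
            pow_le_pow_of_le_one (by norm_num) (by norm_num) (by omega)
          rw [pow_succ] at h1
          linarith [ha.1, hb.2]
        rw [if_neg h0] at ih1
        rw [heq]
        rw [show codeWeight none = 0 from rfl, add_zero]
        exact ⟨ih1, fun _ => ih2 h0⟩

/-- The requests of each string are paid for by its own weight, so the bound `1` on the total weight
of all strings carries over to all requests. -/
theorem sum_levelRequest_le {g : ℕ → Option ℕ}
    (hg : ∀ N, ∑ i ∈ Finset.range N, codeWeight (g i) ≤ 1) (N : ℕ) :
    ∑ i ∈ Finset.range N, codeWeight (levelRequest g i) ≤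
      ∑ i ∈ Finset.range N, codeWeight (g i) := by
  have h := hg N
  rw [sum_codeWeight_eq_dyadicSum] at h
  rw [sum_codeWeight_eq_dyadicSum g]
  rw [div_le_one (by positivity)] at h
  refine (levelRequest_spec hg N).1.trans ?_
  split_ifs with h0
  · positivity
  · exact (dyadicLevel_bounds h0 (by exact_mod_cast h)).1

theorem exists_levelRequest {g : ℕ → Option ℕ}
    (hg : ∀ N, ∑ i ∈ Finset.range N, codeWeight (g i) ≤ 1) (N : ℕ)
    (hN : 0 < ∑ i ∈ Finset.range N, codeWeight (g i)) :
    ∃ i k, levelRequest g i = some (k + 1) ∧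
      ∑ i ∈ Finset.range N, codeWeight (g i) ≤ 2 * (1 / 2) ^ k := by
  have h := hg N
  rw [sum_codeWeight_eq_dyadicSum] at h hN ⊢
  rw [div_le_one (by positivity)] at h
  have h0 : (dyadicSum g N).1 ≠ 0 := by
    intro h0
    simp [h0] at hN
  obtain ⟨i, hi⟩ := (levelRequest_spec hg N).2 h0
  exact ⟨i, _, hi, (dyadicLevel_bounds h0 (by exact_mod_cast h)).2.le⟩

theorem primrec_dyadicLevel : Primrec dyadicLevel := by
  refine Primrec.nat_sub.comp Primrec.snd (Primrec.nat_findGreatest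
    (f := fun s : ℕ × ℕ => s.2) (p := fun s j => 2 ^ j ≤ s.1) Primrec.snd ?_)
  exact Primrec.nat_le.comp (Primrec.nat_pow.comp (Primrec.const 2) Primrec.snd)
    (Primrec.fst.comp Primrec.fst)

theorem computable_levelRequest {α : Type*} [Primcodable α] {g : α → ℕ → Option ℕ}
    (hg : Computable₂ g) : Computable₂ fun a i => levelRequest (g a) i := by
  have hd := computable_dyadicSum hg
  have h0 : Computable fun p : (α × ℕ) × ℕ => dyadicSum (g p.1.1) p.1.2 :=
    Computable.comp (f := fun z : α × ℕ => dyadicSum (g z.1) z.2) hd Computable.fst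
  have h1 : Computable fun p : (α × ℕ) × ℕ => dyadicSum (g p.1.1) (p.1.2 + 1) :=
    Computable.comp (f := fun z : α × ℕ => dyadicSum (g z.1) z.2)
      (g := fun p : (α × ℕ) × ℕ => (p.1.1, p.1.2 + 1)) hd ((Computable.fst.comp
        Computable.fst).pair (Computable.succ.comp (Computable.snd.comp Computable.fst)))
  have hl := primrec_dyadicLevel.to_comp
  have hc : Computable fun p : (α × ℕ) × ℕ =>
      decide ((dyadicSum (g p.1.1) p.1.2).1 = 0) ||
        decide (dyadicLevel (dyadicSum (g p.1.1) (p.1.2 + 1)) <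
          dyadicLevel (dyadicSum (g p.1.1) p.1.2)) :=
    Primrec.or.to_comp.comp
      (Primrec.eq.decide.to_comp.comp (Computable.fst.comp h0) (Computable.const 0))
      (Primrec.nat_lt.decide.to_comp.comp (hl.comp h1) (hl.comp h0))
  have hb := Computable.cond hc (Computable.option_some.comp (Computable.succ.comp (hl.comp h1)))
    (Computable.const none)
  have hg' : Computable fun z : α × ℕ => g z.1 z.2 := hg
  exact (Computable.option_bind hg' hb.to₂).to₂

/-- Of a sequence of lengths and strings, the lengths that go with the string `x`. -/
def lengthsOf (e : ℕ → Option (ℕ × List Bool)) (x : List Bool) (i : ℕ) : Option ℕ :=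
  (e i).bind fun r => bif decide (r.2 = x) then some r.1 else none

theorem computable_lengthsOf {e : ℕ → Option (ℕ × List Bool)} (he : Computable e) :
    Computable₂ (lengthsOf e) := by
  refine Computable.option_bind (he.comp Computable.snd) ?_
  exact Computable.cond (Primrec.eq.decide.to_comp.comp (Computable.snd.comp Computable.snd)
    (Computable.fst.comp Computable.fst))
    (Computable.option_some.comp (Computable.fst.comp Computable.snd)) (Computable.const none)

theorem lengthsOf_eq_some {e : ℕ → Option (ℕ × List Bool)} {x : List Bool} {i l : ℕ} :
    lengthsOf e x i = some l ↔ e i = some (l, x) := by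
  unfold lengthsOf
  rcases e i with _ | ⟨m, z⟩
  · simp
  · by_cases h : z = x <;> simp [h]

/-- The coding theorem: from a computable sequence of lengths and strings, with the sum of all
weights at most `1`, one gets programs whose weight is, up to a constant factor, at least the total
weight of the string. -/
theorem exists_machine_of_weights {e : ℕ → Option (ℕ × List Bool)} (he : Computable e)
    (hsum : ∀ N, ∑ i ∈ Finset.range N, codeWeight ((e i).map Prod.fst) ≤ 1) :
    ∃ T : SelfDelimitingMachine, ∀ x N,
      0 < ∑ i ∈ Finset.range N, codeWeight (lengthsOf e x i) → ∃ p, T.Outputs p [] x ∧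
        ∑ i ∈ Finset.range N, codeWeight (lengthsOf e x i) ≤ 8 * (1 / 2) ^ p.length := by
  -- The requests of all strings in one sequence: a string can make a request only at a time when it
  -- occurs in `e`, so none is lost.
  let f : ℕ → Option (ℕ × List Bool) := fun i =>
    (e i).bind fun r => (levelRequest (lengthsOf e r.2) i).map fun k => (k, r.2)
  have hf : Computable f := by
    refine Computable.option_bind he ?_
    have hr : Computable fun z : List Bool × ℕ => levelRequest (lengthsOf e z.1) z.2 :=
      computable_levelRequest (computable_lengthsOf he)
    have hz : Computable fun z : ℕ × ℕ × List Bool => (z.2.2, z.1) :=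
      (Computable.snd.comp Computable.snd).pair Computable.fst
    have hk : Computable₂ fun (z : ℕ × ℕ × List Bool) (k : ℕ) => (k, z.2.2) :=
      Computable.snd.pair (Computable.snd.comp (Computable.snd.comp Computable.fst))
    have h := Computable.option_map (hr.comp hz) hk
    exact h
  have hcases : ∀ x i, lengthsOf e x i = none ∨ ∃ l, e i = some (l, x) := by
    intro x i
    cases h : lengthsOf e x i with
    | none => exact .inl rfl
    | some l => exact .inr ⟨l, lengthsOf_eq_some.1 h⟩
  have hone : ∀ x N, ∑ i ∈ Finset.range N, codeWeight (lengthsOf e x i) ≤ 1 := by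
    refine fun x N => (Finset.sum_le_sum fun i _ => ?_).trans (hsum N)
    rcases hcases x i with h | ⟨l, h⟩
    · rw [h]; exact codeWeight_nonneg _
    · rw [h, lengthsOf_eq_some.2 h]; rfl
  have hfsum : ∀ N, ∑ i ∈ Finset.range N, codeWeight ((f i).map Prod.fst) ≤ 1 := by
    intro N
    -- The finitely many strings seen before time `N`; a spurious `[]` from times without an entry
    -- only adds zero terms. Each time concerns at most one string, so the sum over times splits
    -- into sums over `X`, which are compared string by string.
    let X := (Finset.range N).image fun i => ((e i).map Prod.snd).getD []
    have hsplit : ∀ i ∈ Finset.range N, ∀ G : List Bool → Option ℕ,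
        (∀ x, lengthsOf e x i = none → G x = none) →
        codeWeight ((e i).bind fun r => G r.2) = ∑ x ∈ X, codeWeight (G x) := by
      intro i hi G hG
      rcases h : e i with _ | ⟨l, x⟩
      · symm
        simp only [Option.bind_none]
        refine Finset.sum_eq_zero fun x _ => ?_
        rw [hG x (by simp [lengthsOf, h])]
        rfl
      · rw [Option.bind_some, Finset.sum_eq_single x]
        · intro z _ hz
          rw [hG z (by simp [lengthsOf, h, Ne.symm hz])]
          rfl
        · intro hx
          exact absurd (Finset.mem_image.2 ⟨i, hi, by simp [h]⟩) hx
    have h1 : ∀ i ∈ Finset.range N, codeWeight ((f i).map Prod.fst) =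
        ∑ x ∈ X, codeWeight (levelRequest (lengthsOf e x) i) := by
      intro i hi
      rw [← hsplit i hi (fun x => levelRequest (lengthsOf e x) i)
        fun x hx => by simp [levelRequest, hx]]
      simp only [f, Option.map_bind]
      congr 2
      funext r
      simp [Function.comp_def]
    have h2 : ∀ i ∈ Finset.range N, codeWeight ((e i).map Prod.fst) =
        ∑ x ∈ X, codeWeight (lengthsOf e x i) := by
      intro i hi
      rw [← hsplit i hi (fun x => lengthsOf e x i) fun x hx => hx]
      congr 1
      rcases h : e i with _ | ⟨l, x⟩
      · rfl
      · simp [lengthsOf, h]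
    refine le_trans ?_ (hsum N)
    rw [Finset.sum_congr rfl h1, Finset.sum_congr rfl h2, Finset.sum_comm,
      Finset.sum_comm (s := Finset.range N)]
    exact Finset.sum_le_sum fun x _ => sum_levelRequest_le (hone x) N
  obtain ⟨T, hT⟩ := exists_machine_of_requests (α := Unit) (f := fun _ => f)
    (hf.comp Computable.snd) (Computable.const ()).partrec
  refine ⟨T, fun x N hN => ?_⟩
  obtain ⟨i, k, hi, hk⟩ := exists_levelRequest (hone x) N hN
  have hei : ∃ l, e i = some (l, x) := by
    rcases hcases x i with h | h
    · simp [levelRequest, h] at hi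
    · exact h
  obtain ⟨l, hl⟩ := hei
  obtain ⟨p, hp, hout⟩ := hT [] () (Part.mem_some _) hfsum i (k + 1) x (by simp [f, hl, hi])
  -- The weight is at most `2 * 2^{-k}`. The request is for length `k + 1` and the codeword has
  -- length `k + 2`, hence the factor `8`.
  refine ⟨p, hout, hk.trans_eq ?_⟩
  rw [hp]
  ring

/-! ### Decoding pairs, and the easy half of the chain rule -/

namespace SelfDelimitingMachine

/-- The first component of a pair of strings. -/
def unpairFst (z : List Bool) : List Bool :=
  (z.drop (z.idxOf false + 1)).take (z.idxOf false)

/-- The second component of a pair of strings. -/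
def unpairSnd (z : List Bool) : List Bool :=
  (z.drop (z.idxOf false + 1)).drop (z.idxOf false)

theorem primrec_idxOf_false : Primrec fun z : List Bool => z.idxOf false :=
  Primrec.list_idxOf.comp (Primrec.const false) Primrec.id

theorem primrec_drop_idxOf_false :
    Primrec fun z : List Bool => z.drop (z.idxOf false + 1) :=
  Primrec.list_drop.comp (Primrec.succ.comp primrec_idxOf_false) Primrec.id

theorem computable_unpairFst : Computable unpairFst :=
  (Primrec.list_take.comp primrec_idxOf_false primrec_drop_idxOf_false).to_comp

theorem computable_unpairSnd : Computable unpairSnd :=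
  (Primrec.list_drop.comp primrec_idxOf_false primrec_drop_idxOf_false).to_comp

theorem idxOf_false_replicate_append (n : ℕ) (t : List Bool) :
    (List.replicate n true ++ false :: t).idxOf false = n := by
  induction n with
  | zero => rfl
  | succ n ih => simp [List.replicate_succ, ih]

theorem drop_replicate_append (n : ℕ) (t : List Bool) :
    (List.replicate n true ++ false :: t).drop (n + 1) = t := by
  induction n with
  | zero => rfl
  | succ n ih => simpa [List.replicate_succ] using ih

theorem unpairFst_pairing (x y : List Bool) : unpairFst (pairing x y) = x := by
  simp only [unpairFst, pairing, selfDelimitingCode, List.append_assoc, List.cons_append,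
    idxOf_false_replicate_append, drop_replicate_append, List.take_left]

theorem unpairSnd_pairing (x y : List Bool) : unpairSnd (pairing x y) = y := by
  simp only [unpairSnd, pairing, selfDelimitingCode, List.append_assoc, List.cons_append,
    idxOf_false_replicate_append, drop_replicate_append, List.drop_left]

theorem computable_pairing : Computable₂ pairing := by
  have hrep : Primrec fun p : List Bool × List Bool =>
      List.replicate p.1.length true ++ false :: p.1 ++ p.2 := by
    have h1 : Primrec fun x : List Bool => List.replicate x.length true :=
      (Primrec.list_map Primrec.id ((Primrec.const true).to₂)).of_eq fun x => by simp
    exact Primrec.list_append.comp (Primrec.list_append.comp (h1.comp Primrec.fst)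
      (Primrec.list_cons.comp (Primrec.const false) Primrec.fst)) Primrec.snd
  exact hrep.to_comp

variable {T U : SelfDelimitingMachine} {p q x y : List Bool}

theorem condK_le (h : T.Outputs p y x) : T.condK x y ≤ p.length :=
  iInf₂_le p h

theorem condK_eq_top_or_exists (T : SelfDelimitingMachine) (x y : List Bool) :
    T.condK x y = ⊤ ∨ ∃ p, T.Outputs p y x ∧ (p.length : ℕ∞) ≤ T.condK x y := by
  refine or_iff_not_imp_left.2 fun h => ?_
  have hlt : T.condK x y < T.condK x y + 1 := (ENat.lt_add_one_iff h).2 le_rfl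
  nth_rewrite 1 [condK] at hlt
  obtain ⟨p, hp⟩ := iInf_lt_iff.1 hlt
  obtain ⟨hout, hp⟩ := iInf_lt_iff.1 hp
  exact ⟨p, hout, (ENat.lt_add_one_iff h).1 hp⟩

/-- A machine that reads a program of `x` and then a program of `y` given the first program, and
outputs the pair of `x` and `y`. -/
theorem exists_machine_pairing (U : SelfDelimitingMachine) :
    ∃ T : SelfDelimitingMachine, ∀ p q x y, U.Outputs p [] x → U.Outputs q p y →
      T.Outputs (p ++ q) [] (pairing x y) := by
  -- `n` is the length of the first program, or `|s| + 1` if it is not yet complete, in which case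
  -- another bit is requested. For `n ≤ |s|` the value `o` is a genuine output, so the default of
  -- `getD` is never used.
  let control : List Bool → List Bool →. Option (List Bool) := fun s _ =>
    (U.scan s []).bind fun n => bif decide (n ≤ s.length) then
      (U.control (s.take n) []).bind fun o =>
        (U.control (s.drop n) (s.take n)).map fun r => r.map (pairing (o.getD []))
    else Part.some none
  have hcontrol : Partrec₂ control := by
    have hscan : Partrec fun z : List Bool × List Bool => U.scan z.1 [] :=
      U.partrec_scan.comp Computable.fst (Computable.const [])
    have htake : Computable fun z : (List Bool × List Bool) × ℕ => z.1.1.take z.2 :=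
      (Primrec.list_take.comp Primrec.snd (Primrec.fst.comp Primrec.fst)).to_comp
    have hdrop : Computable fun z : (List Bool × List Bool) × ℕ => z.1.1.drop z.2 :=
      (Primrec.list_drop.comp Primrec.snd (Primrec.fst.comp Primrec.fst)).to_comp
    have hle : Computable fun z : (List Bool × List Bool) × ℕ => decide (z.2 ≤ z.1.1.length) :=
      (Primrec.nat_le.decide.comp Primrec.snd
        (Primrec.list_length.comp (Primrec.fst.comp Primrec.fst))).to_comp
    have h1 : Partrec fun z : (List Bool × List Bool) × ℕ => U.control (z.1.1.take z.2) [] :=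
      U.computable.comp htake (Computable.const [])
    have h2 : Partrec fun w : ((List Bool × List Bool) × ℕ) × Option (List Bool) =>
        U.control (w.1.1.1.drop w.1.2) (w.1.1.1.take w.1.2) :=
      U.computable.comp (hdrop.comp Computable.fst) (htake.comp Computable.fst)
    have h3 : Computable₂ fun (w : ((List Bool × List Bool) × ℕ) × Option (List Bool))
        (r : Option (List Bool)) => r.map (pairing (w.2.getD [])) := by
      have h4 : Computable₂ fun (v : (((List Bool × List Bool) × ℕ) × Option (List Bool)) ×
          Option (List Bool)) (t : List Bool) => pairing (v.1.2.getD []) t :=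
        computable_pairing.comp (Computable.option_getD
          (Computable.snd.comp (Computable.fst.comp Computable.fst)) (Computable.const []))
          Computable.snd
      exact (Computable.option_map Computable.snd h4).to₂
    exact hscan.bind (Partrec.cond hle (h1.bind (h2.map h3).to₂)
      (Computable.const none).partrec).to₂
  refine ⟨⟨control, hcontrol⟩, fun p q x y hp hq => ?_⟩
  have key : ∀ t o, o ∈ U.control t p → o.map (pairing x) ∈ control (p ++ t) [] := by
    intro t o ho
    refine Part.mem_bind (hp.mem_scan t) ?_
    have h1 : p.length ≤ (p ++ t).length := by simp
    simp only [h1, decide_true, cond_true, List.take_left, List.drop_left]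
    refine Part.mem_bind hp.2 ?_
    exact (Part.mem_map_iff _).2 ⟨o, ho, by simp⟩
  refine ⟨fun s hs hne => ?_, by simpa using key q _ hq.2⟩
  by_cases hps : p <+: s
  · obtain ⟨t, rfl⟩ := hps
    exact key t none (hq.1 t ((List.prefix_append_right_inj p).1 hs) fun h => hne (h ▸ rfl))
  · have hsp : s <+: p :=
      (List.prefix_or_prefix_of_prefix hs (List.prefix_append p q)).resolve_right hps
    have hscan : s.length + 1 ∈ U.scan s [] := mem_scan_of_none fun u hu =>
      hp.1 u (hu.trans hsp) fun h => hps (h ▸ hu)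
    refine Part.mem_bind hscan ?_
    simp

/-- The easy half of the chain rule. -/
theorem IsUniversal.K₂_le (hU : U.IsUniversal) :
    ∃ c : ℕ, ∀ x y p, U.IsShortestProgram p x → U.K₂ x y ≤ U.K x + U.condK y p + c := by
  obtain ⟨T, hT⟩ := exists_machine_pairing U
  obtain ⟨r, hr⟩ := hU T
  refine ⟨r.length, fun x y p hp => ?_⟩
  rcases U.condK_eq_top_or_exists y p with h | ⟨q, hq, hle⟩
  · simp [h]
  · refine (condK_le ((hr _ _ _).2 (hT p q x y hp.1 hq))).trans ?_
    rw [← hp.2]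
    calc ((r ++ (p ++ q)).length : ℕ∞) = p.length + q.length + r.length := by
          push_cast [List.length_append]; ring
      _ ≤ _ := by gcongr

/-! ### The hard half of the chain rule -/

/-- Kraft's inequality for the programs of a machine, enumerated without repetition. -/
theorem sum_codeWeight_programs_le {e : ℕ → Option (List Bool × List Bool)}
    (hsound : ∀ i p x, e i = some (p, x) → U.Outputs p y x)
    (hinj : ∀ i j p x x', e i = some (p, x) → e j = some (p, x') → i = j) (N : ℕ) :
    ∑ i ∈ Finset.range N, codeWeight ((e i).map fun r => r.1.length) ≤ 1 := by
  let I := (Finset.range N).filter fun i => (e i).isSome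
  let P : ℕ → List Bool := fun i => ((e i).map Prod.fst).getD []
  have hI : ∀ i ∈ I, ∃ x, e i = some (P i, x) := by
    intro i hi
    obtain ⟨⟨p, x⟩, h⟩ := Option.isSome_iff_exists.1 (Finset.mem_filter.1 hi).2
    exact ⟨x, by simp [P, h]⟩
  have hinjOn : Set.InjOn P I := by
    intro i hi j hj h
    obtain ⟨x, hx⟩ := hI i hi
    obtain ⟨x', hx'⟩ := hI j hj
    exact hinj i j _ x x' hx (h ▸ hx')
  calc ∑ i ∈ Finset.range N, codeWeight ((e i).map fun r => r.1.length)
      = ∑ i ∈ I, codeWeight ((e i).map fun r => r.1.length) := by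
        refine (Finset.sum_filter_of_ne fun i _ h => ?_).symm
        by_contra h'
        simp [Option.not_isSome_iff_eq_none.1 h', codeWeight] at h
    _ = ∑ i ∈ I, (1 / 2 : ℝ) ^ (P i).length := by
        refine Finset.sum_congr rfl fun i hi => ?_
        obtain ⟨x, hx⟩ := hI i hi
        rw [hx]
        rfl
    _ = ∑ w ∈ I.image P, (1 / 2 : ℝ) ^ w.length := 
      (Finset.sum_image (f := fun w : List Bool => (1 / 2 : ℝ) ^ w.length) hinjOn).symm
    _ ≤ 1 := by
        refine sum_pow_length_le_one_of_prefixFree fun p hp q hq hpq => ?_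
        obtain ⟨i, hi, rfl⟩ := Finset.mem_image.1 hp
        obtain ⟨j, hj, rfl⟩ := Finset.mem_image.1 hq
        obtain ⟨x, hx⟩ := hI i hi
        obtain ⟨x', hx'⟩ := hI j hj
        exact (hsound _ _ _ hx).eq_of_prefix (hsound _ _ _ hx') hpq

/-- The requests, given a string `x` and a number `k`, for programs of the second components of the
strings in the sequence `e` that have first component `x`: lengths change from `l` to `l + c - k`. -/
def conditionalRequest (e : ℕ → Option (ℕ × List Bool)) (c : ℕ) (a : List Bool × ℕ) (i : ℕ) :
    Option (ℕ × List Bool) :=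
  (e i).bind fun r =>
    bif decide (unpairFst r.2 = a.1) then some (r.1 + c - a.2, unpairSnd r.2) else none

theorem computable_conditionalRequest {e : ℕ → Option (ℕ × List Bool)} (he : Computable e)
    (c : ℕ) : Computable₂ (conditionalRequest e c) := by
  let ρ := ((List Bool × ℕ) × ℕ) × (ℕ × List Bool)
  have hz : Computable fun w : ρ => w.2.2 := Computable.snd.comp Computable.snd
  have ha : Computable fun w : ρ => w.1.1 := Computable.fst.comp Computable.fst
  have hc : Computable fun w : ρ => decide (unpairFst w.2.2 = w.1.1.1) :=
    Primrec.eq.decide.to_comp.comp (computable_unpairFst.comp hz) (Computable.fst.comp ha)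
  have hl : Computable fun w : ρ => w.2.1 + c - w.1.1.2 :=
    Primrec.nat_sub.to_comp.comp (Primrec.nat_add.to_comp.comp
      (Computable.fst.comp Computable.snd) (Computable.const c)) (Computable.snd.comp ha)
  have hb := Computable.cond hc
    (Computable.option_some.comp (hl.pair (computable_unpairSnd.comp hz))) (Computable.const none)
  exact (Computable.option_bind (he.comp Computable.snd) hb.to₂).to₂

/-- Changing a length from `l` to `l + c - k` multiplies its weight by `2^{k-c}`. Where the
subtraction truncates, the actual length is larger than the integer `l + c - k`, so the weight is
only smaller. -/
theorem codeWeight_conditionalRequest_le (e : ℕ → Option (ℕ × List Bool)) (c : ℕ)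
    (x : List Bool) (k i : ℕ) :
    codeWeight ((conditionalRequest e c (x, k) i).map Prod.fst) ≤
      codeWeight (lengthsOf (fun j => (e j).map fun r => (r.1, unpairFst r.2)) x i) *
        (2 ^ k / 2 ^ c) := by
  have hnonneg : ∀ o, 0 ≤ codeWeight o * (2 ^ k / 2 ^ c : ℝ) := fun o =>
    mul_nonneg (codeWeight_nonneg o) (by positivity)
  unfold conditionalRequest
  rcases hi : e i with _ | ⟨l, z⟩
  · exact hnonneg _
  · by_cases h : unpairFst z = x
    · rw [lengthsOf_eq_some.2 (show (e i).map (fun r => (r.1, unpairFst r.2)) = some (l, x) by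
        simp [hi, h])]
      simp only [Option.bind_some, Option.map_some, h, decide_true, cond_true, codeWeight,
        Option.elim_some]
      have h1 : (2 : ℝ) ^ (l + c) ≤ 2 ^ k * 2 ^ (l + c - k) := by
        rw [← pow_add]
        exact pow_le_pow_right₀ (by norm_num) (by omega)
      rw [one_div, inv_pow, inv_pow, ← div_eq_inv_mul, div_div, inv_eq_one_div,
        div_le_div_iff₀ (by positivity) (by positivity), ← pow_add, one_mul, add_comm c l]
      exact h1
    · simpa [h, codeWeight] using hnonneg _

/-- The hard half of the chain rule. -/
theorem IsUniversal.le_K₂ (hU : U.IsUniversal) :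
    ∃ c : ℕ, ∀ x y p, U.IsShortestProgram p x → U.K x + U.condK y p ≤ U.K₂ x y + c := by
  have hout : Partrec fun p => U.output p [] :=
    U.partrec_output.comp Computable.id (Computable.const [])
  obtain ⟨E, hE, hmem, hinj⟩ := exists_enumeration_of_partrec hout
  have hsound : ∀ i p x, E i = some (p, x) → U.Outputs p [] x := fun i p x h =>
    mem_output_iff.1 ((hmem p x).2 ⟨i, h⟩)
  let e : ℕ → Option (ℕ × List Bool) := fun i => (E i).map fun r => (r.1.length, r.2)
  have he : Computable e := Computable.option_map hE ((Computable.list_length.comp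
    (Computable.fst.comp Computable.snd)).pair (Computable.snd.comp Computable.snd)).to₂
  -- `unpairFst` is total, so outputs that are not pairs also contribute to some `x`; Kraft's
  -- inequality covers them as well.
  let e₁ : ℕ → Option (ℕ × List Bool) := fun i => (e i).map fun r => (r.1, unpairFst r.2)
  have he₁ : Computable e₁ := Computable.option_map he ((Computable.fst.comp
    Computable.snd).pair (computable_unpairFst.comp (Computable.snd.comp Computable.snd))).to₂
  have hsum : ∀ N, ∑ i ∈ Finset.range N, codeWeight ((e₁ i).map Prod.fst) ≤ 1 := by
    intro N
    have h := sum_codeWeight_programs_le hsound hinj N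
    simpa only [e₁, e, Option.map_map, Function.comp_def] using h
  obtain ⟨T, hT⟩ := exists_machine_of_weights he₁ hsum
  obtain ⟨r, hr⟩ := hU T
  -- The coding theorem gives a program `q` of `x` on `T` with `m(x) ≤ 8 * 2^{-|q|}`, and `K(x) ≤
  -- |r| + |q|` by simulation. Hence the constant `|r| + 3`.
  have hbound : ∀ x p, U.IsShortestProgram p x → ∀ N,
      (∑ i ∈ Finset.range N, codeWeight (lengthsOf e₁ x i)) *
        (2 ^ p.length / 2 ^ (r.length + 3)) ≤ 1 := by
    intro x p hp N
    rcases (Finset.sum_nonneg fun i _ => codeWeight_nonneg (lengthsOf e₁ x i) :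
      0 ≤ ∑ i ∈ Finset.range N, codeWeight (lengthsOf e₁ x i)).eq_or_lt with h | h
    · rw [← h]; simp
    · obtain ⟨q, hq, hle⟩ := hT x N h
      have hlen : p.length ≤ r.length + q.length := by
        have h1 := hp.2.trans_le (condK_le ((hr _ _ _).2 hq))
        rw [List.length_append] at h1
        exact_mod_cast h1
      have hpow : (2 : ℝ) ^ p.length ≤ 2 ^ r.length * 2 ^ q.length := by
        rw [← pow_add]
        exact pow_le_pow_right₀ (by norm_num) hlen
      refine (mul_le_mul_of_nonneg_right hle (by positivity)).trans ?_
      rw [one_div, inv_pow, pow_add]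
      rw [← div_eq_mul_inv, div_mul_div_comm, div_le_one (by positivity)]
      nlinarith
  let c := r.length + 3
  -- The auxiliary information `p` is run on `U` to obtain `x`, and its length supplies `K(x)`. This
  -- is where a shortest program is needed rather than `x` alone.
  obtain ⟨V, hV⟩ := exists_machine_of_requests (computable_conditionalRequest he c)
    (hout.map (g := fun p x => (x, p.length)) (Computable.snd.pair
      (Computable.list_length.comp Computable.fst)).to₂)
  obtain ⟨s, hs⟩ := hU V
  -- The `1` is the extra bit that greedy allocation adds to each codeword.
  refine ⟨c + s.length + 1, fun x y p hp => ?_⟩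
  obtain ⟨q, hq, hqlen⟩ := hU.exists_isShortestProgram (pairing x y)
  obtain ⟨i, hi⟩ := (hmem q (pairing x y)).1 (mem_output_iff.2 hq)
  have hei : e i = some (q.length, pairing x y) := by simp [e, hi]
  -- The single term `2^{-|q|}` already obeys `hbound`. So the subtraction in the requested length
  -- does not truncate, and `|p|` cancels in the final count.
  have hlen : p.length ≤ q.length + c := by
    have h1 : codeWeight (lengthsOf e₁ x i) = (1 / 2) ^ q.length := by
      rw [lengthsOf_eq_some.2 (show e₁ i = some (q.length, x) by
        simp [e₁, hei, unpairFst_pairing])]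
      rfl
    have h2 := Finset.single_le_sum (fun j _ => codeWeight_nonneg (lengthsOf e₁ x j))
      (Finset.self_mem_range_succ i)
    have h3 := (mul_le_mul_of_nonneg_right (h1 ▸ h2) (by positivity)).trans
      (hbound x p hp (i + 1))
    rw [one_div, inv_pow, ← div_eq_inv_mul, div_div, div_le_one (by positivity), ← pow_add] at h3
    have h4 := (pow_le_pow_iff_right₀ (by norm_num : (1 : ℝ) < 2)).1 h3
    omega
  obtain ⟨t, ht, hVt⟩ := hV p (x, p.length)
    ((Part.mem_map_iff _).2 ⟨x, mem_output_iff.2 hp.1, rfl⟩)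
    (fun N => by
      refine (Finset.sum_le_sum fun j _ =>
        codeWeight_conditionalRequest_le e c x p.length j).trans ?_
      rw [← Finset.sum_mul]
      exact hbound x p hp N)
    i (q.length + c - p.length) y
    (by simp [conditionalRequest, hei, unpairFst_pairing, unpairSnd_pairing])
  have hK : U.condK y p ≤ ((s ++ t).length : ℕ∞) := condK_le ((hs _ _ _).2 hVt)
  have hK₂ : U.K₂ x y = q.length := hqlen.symm
  rw [← hp.2, hK₂]
  refine (add_le_add_right hK _).trans ?_
  rw [List.length_append, ht]
  have : p.length + (s.length + (q.length + c - p.length + 1)) ≤ q.length + (c + s.length + 1) := by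
    omega
  exact_mod_cast this

end SelfDelimitingMachine

theorem mainTheorem2 (U : SelfDelimitingMachine) (hU : U.IsUniversal) :
    ∃ c : ℕ, ∀ x y xstar : List Bool, U.IsShortestProgram xstar x →
      U.K₂ x y ≤ U.K x + U.condK y xstar + (c : ℕ∞) ∧
      U.K x + U.condK y xstar ≤ U.K₂ x y + (c : ℕ∞) := by
  obtain ⟨c₁, h₁⟩ := hU.K₂_le
  obtain ⟨c₂, h₂⟩ := hU.le_K₂
  refine ⟨max c₁ c₂, fun x y p hp => ⟨(h₁ x y p hp).trans ?_, (h₂ x y p hp).trans ?_⟩⟩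
  · gcongr
    exact le_max_left _ _
  · gcongr
    exact le_max_right _ _
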